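/- Let $T$ be a compact metric space and let $\mathbb{C}_0$ be the set of non-negative, not identically zero continuous functions $f:T\to\mathbb{R}$, with the sup norm $\|\cdot\|$ and its Borel $\sigma$-algebra. Let $M_p(\mathbb{C}_0)$ be the set of point measures $M=\sum_{i\in I}\delta_{f_i}$ on $\mathbb{C}_0$ such that for every $\varepsilon>0$ only finitely many indices $i$ satisfy $\|f_i\|>\varepsilon$, with the $\sigma$-algebra generated by the maps $M\mapsto M(A)$, $A\subset\mathbb{C}_0$ Borel. Write $[M]=\{f_i:\ i\in I\}$ for the set of atoms of $M$, and $\max(M)(t)=\max\{f(t):f\in[M]\}$ for $t\in T$, with $\max(0)\equiv 0$. Let $\mu$ be a Borel measure on $\mathbb{C}_0$, let $\Phi=\sum_i\delta_{\phi_i}$ be an $M_p(\mathbb{C}_0)$-valued Poisson random measure with intensity $\mu$, defined on a probability space $(\Omega,\mathcal{F},\mathbb{P})$, and let $\eta=\max(\Phi)$ (so that $\eta$ is a sample continuous max-infinitely divisible random process on $T$ with vertex function $0$ and exponent measure $\mu$). For $t\in T$, let $$\Phi_{\{t\}}^+=\sum_i 1_{\{\phi_i(t)\ge\eta(t)\}}\,\delta_{\phi_i}$$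 be the random measure of $\{t\}$-extremal atoms of $\Phi$, let $\mu_t(B)=\mu(\{f\in\mathbb{C}_0: f(t)\in B\})$ for Borel $B\subset(0,\infty)$, and let $\bar\mu_t(x)=\mu_t([x,\infty))$ for $x>0$, with $\bar\mu_t(0)=\bar\mu_t(0^+)=\lim_{x\downarrow0}\bar\mu_t(x)\in[0,\infty]$. For every $t\in T$ the following statements are equivalent: (i) $\Phi_{\{t\}}^+(\mathbb{C}_0)=1$ almost surely; (ii) $\bar\mu_t(0^+)=+\infty$ and $\bar\mu_t$ is continuous on $(0,\infty)$; (iii) the distribution of $\eta(t)$ has no atom, i.e. $\mathbb{P}(\eta(t)=y)=0$ for every $y\in\mathbb{R}$. If these conditions are met, there is a $\mathbb{C}_0$-valued random variable $\phi_t^+$ (the $t$-extremal function) with $\Phi_{\{t\}}^+=\delta_{\phi_t^+}$ almost surely, and for any such $\phi_t^+$ and every Borel set $A\subset\mathbb{C}_0$, $$\mathbb{P}(\phi_t^+\in A)=\int_A\exp[-\bar\mu_t(f(t))]\,\mu(df),\qquad \text{with } \exp(-\infty)=0.$$ -/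

import Mathlib

open MeasureTheory ProbabilityTheory Filter Topology Set
open scoped ENNReal

namespace MaxID

/-- The space `ℂ₀` of non-negative, non-null continuous functions on `T`, with the topology
induced by the sup norm. -/
abbrev C0 (T : Type*) [TopologicalSpace T] : Type _ :=
  {f : C(T, ℝ) // 0 ≤ f ∧ f ≠ 0}

/-- `ℂ₀` carries its Borel σ-algebra. -/
instance C0.instMeasurableSpace (T : Type*) [TopologicalSpace T] : MeasurableSpace (C0 T) :=
  borel (C0 T)

instance C0.instBorelSpace (T : Type*) [TopologicalSpace T] : BorelSpace (C0 T) := ⟨rfl⟩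

/-- The space `M_p(ℂ₀)` of point measures `M = ∑_{i ∈ I} δ_{f_i}` on `ℂ₀` (multiple points are
allowed) such that, for every `ε > 0`, only finitely many `f_i` satisfy `‖f_i‖ > ε`. -/
def pointMeasures (T : Type*) [TopologicalSpace T] [CompactSpace T] :
    Set (Measure (C0 T)) :=
  {M | ∃ (I : Type) (f : I → C0 T),
      (∀ ε : ℝ, 0 < ε → {i | ε < ‖(f i : C(T, ℝ))‖}.Finite) ∧
      M = Measure.sum (fun i => Measure.dirac (f i))}

/-- The set `[M]` of atoms of `M`. -/
def atoms {T : Type*} [TopologicalSpace T] (M : Measure (C0 T)) : Set (C0 T) :=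
  {f | M {f} ≠ 0}

/-- The function `max(M) : t ↦ max {f(t) ; f ∈ [M]}`. For a non-null `M ∈ M_p(ℂ₀)` the supremum
is attained; for `M = 0` the set is empty and the value is the conventional one, `0`. -/
noncomputable def maxFun {T : Type*} [TopologicalSpace T] (M : Measure (C0 T)) (t : T) : ℝ :=
  sSup ((fun f : C0 T => f.1 t) '' atoms M)

/-- The Poisson distribution with parameter `m ∈ [0, ∞]`, as a law on `[0, ∞]`: the usual one if
`m < ∞`, and the unit mass at `∞` if `m = ∞`. -/
noncomputable def extendedPoisson (m : ℝ≥0∞) : Measure ℝ≥0∞ :=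
  if m = ∞ then Measure.dirac ∞
  else (poissonMeasure m.toNNReal).map (fun n : ℕ => (n : ℝ≥0∞))

/-- `Φ` is an `M_p(ℂ₀)`-valued Poisson random measure with intensity `μ` on the probability space
`(Ω, P)`. The σ-algebra on `Measure (C0 T)` is the one generated by the maps `M ↦ M A` with
`A` Borel. -/
structure IsPoissonRandomMeasure {T : Type*} [TopologicalSpace T] [CompactSpace T]
    {Ω : Type*} [MeasurableSpace Ω] (P : Measure Ω) (μ : Measure (C0 T))
    (Φ : Ω → Measure (C0 T)) : Prop where
  measurable : Measurable Φ
  mem_pointMeasures : ∀ ω, Φ ω ∈ pointMeasures T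
  hasLaw : ∀ A : Set (C0 T), MeasurableSet A →
    HasLaw (fun ω => Φ ω A) (extendedPoisson (μ A)) P
  indep : ∀ (n : ℕ) (A : Fin n → Set (C0 T)), (∀ i, MeasurableSet (A i)) →
    Pairwise (fun i j => Disjoint (A i) (A j)) → iIndepFun (fun i ω => Φ ω (A i)) P

/-- `f <_K g`: `f(s) < g(s)` for all `s ∈ K`. -/
def LtOn {T : Type*} (K : Set T) (f g : T → ℝ) : Prop := ∀ s ∈ K, f s < g s

/-- For `M = ∑ δ_{f_i}` this is `∑ 1_{f_i ≮_K g} δ_{f_i}`. With `M = Φ` and `g = η = max(Φ)` it is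
the `K`-extremal point measure `Φ_K^+`. -/
noncomputable def extremalMeasure {T : Type*} [TopologicalSpace T] (M : Measure (C0 T))
    (g : C(T, ℝ)) (K : Set T) : Measure (C0 T) :=
  M.restrict {f | ¬ LtOn K f.1 g}

/-- The measure `μ_t(B) = μ {f ; f(t) ∈ B}` on `(0, ∞)`, as a measure on `ℝ` carried by
`(0, ∞)`. -/
noncomputable def evalMeasure {T : Type*} [TopologicalSpace T] (μ : Measure (C0 T)) (t : T) :
    Measure ℝ :=
  (μ.map (fun f : C0 T => f.1 t)).restrict (Ioi 0)

/-- The tail function `x ↦ μ_t [x, ∞)`. At `x = 0` this is `μ_t (0, ∞)`, the right limit at `0`. -/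
noncomputable def tail {T : Type*} [TopologicalSpace T] (μ : Measure (C0 T)) (t : T) (x : ℝ) :
    ℝ≥0∞ :=
  evalMeasure μ t (Ici x)

end MaxID

open MaxID

set_option linter.unusedSectionVars false

/-! Everything is read off Poisson counts of disjoint sets of functions sorted by their value at
`t`. The maximum at `t` equals `x > 0` exactly when some atom takes the value `x` and none exceeds
it, and equals `0` exactly when no atom is positive at `t`. This gives the atoms of the law of
`η(t)` explicitly (`forall_measure_maxFun_eq_zero_iff`). If `x` carries positive mass, two atoms tie
at the maximum with positive probability. If the total mass is finite, with positive probability all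
atoms vanish at `t`, and then all of them are extremal. Either way (i) fails
(`no_atom_of_extremal`).

For the converse and the law, values at `t` are cut into cells of width `1/(n+1)`. The event that
one atom lies in `A` and cell `k`, and no other atom reaches level `k/(n+1)`, has a product
probability. Summing over `k` and applying Fatou gives `∫_A exp(-tail) dμ ≤ P(U_A)`, where on `U_A`
almost surely the extremal measure is a single atom in `A` (`lintegral_expTail_le`). A union bound
on the same grid shows that the density has total integral at least 1 (`one_le_lintegral_expTail`).
Taking `A = univ` gives (i). Since `U_A` and `U_{Aᶜ}` are almost surely disjoint, both lower bounds
must be equalities, which is the formula for the law. -/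

namespace MaxID

/-! ### Poisson laws with a possibly infinite parameter -/

section ExtendedPoisson

lemma exp_neg_coe_ennreal_le_one (m : ℝ≥0∞) : EReal.exp (-(m : EReal)) ≤ 1 := by
  simp [EReal.coe_ennreal_nonneg]

lemma exp_neg_coe_ennreal_add (a b : ℝ≥0∞) :
    EReal.exp (-((a + b : ℝ≥0∞) : EReal)) = EReal.exp (-(a : EReal)) * EReal.exp (-(b : EReal)) := by
  rw [← EReal.exp_add, EReal.coe_ennreal_add, EReal.neg_add, sub_eq_add_neg] <;> simp

lemma exp_neg_coe_ennreal_of_ne_top {m : ℝ≥0∞} (hm : m ≠ ∞) :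
    EReal.exp (-(m : EReal)) = ENNReal.ofReal (Real.exp (-m.toReal)) := by
  lift m to NNReal using hm
  rw [← EReal.exp_coe]
  rfl

lemma exp_neg_coe_ennreal_eq_zero {m : ℝ≥0∞} : EReal.exp (-(m : EReal)) = 0 ↔ m = ∞ := by
  rw [EReal.exp_eq_zero_iff]
  simp

instance (m : ℝ≥0∞) : IsProbabilityMeasure (extendedPoisson m) := by
  unfold extendedPoisson
  split_ifs
  · infer_instance
  · exact Measure.isProbabilityMeasure_map .of_discrete

lemma extendedPoisson_singleton_natCast {m : ℝ≥0∞} (hm : m ≠ ∞) (n : ℕ) :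
    extendedPoisson m {(n : ℝ≥0∞)} =
      ENNReal.ofReal (Real.exp (-m.toReal) * m.toReal ^ n / (n.factorial : ℝ)) := by
  rw [extendedPoisson, if_neg hm, Measure.map_apply .of_discrete (measurableSet_singleton _)]
  have : (fun k : ℕ => (k : ℝ≥0∞)) ⁻¹' {(n : ℝ≥0∞)} = {n} := by ext; simp
  rw [this, poissonMeasure_singleton]
  rfl

lemma extendedPoisson_singleton_zero (m : ℝ≥0∞) :
    extendedPoisson m {0} = EReal.exp (-(m : EReal)) := by
  by_cases hm : m = ∞
  · simp [extendedPoisson, hm]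
  · have := extendedPoisson_singleton_natCast hm 0
    rw [exp_neg_coe_ennreal_of_ne_top hm]
    simpa using this

lemma extendedPoisson_singleton_one {m : ℝ≥0∞} (hm : m ≠ ∞) :
    extendedPoisson m {1} = m * EReal.exp (-(m : EReal)) := by
  have := extendedPoisson_singleton_natCast hm 1
  rw [exp_neg_coe_ennreal_of_ne_top hm]
  simp only [Nat.cast_one, pow_one, Nat.factorial_one, div_one] at this
  rw [this, mul_comm, ENNReal.ofReal_mul ENNReal.toReal_nonneg, ENNReal.ofReal_toReal hm]

/-- This is `1 - exp(-m) ≤ m`, which bounds the cell terms in the union bound. -/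
lemma extendedPoisson_compl_zero_le (m : ℝ≥0∞) : extendedPoisson m {0}ᶜ ≤ m := by
  by_cases hm : m = ∞
  · simp [hm]
  · rw [prob_compl_eq_one_sub (measurableSet_singleton _), extendedPoisson_singleton_zero,
      exp_neg_coe_ennreal_of_ne_top hm, ← ENNReal.ofReal_one,
      ← ENNReal.ofReal_sub _ (Real.exp_pos _).le]
    refine ENNReal.ofReal_le_of_le_toReal ?_
    linarith [Real.add_one_le_exp (-m.toReal)]

lemma extendedPoisson_compl_zero_eq_zero {m : ℝ≥0∞} : extendedPoisson m {0}ᶜ = 0 ↔ m = 0 := by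
  rw [prob_compl_eq_zero_iff (measurableSet_singleton _), extendedPoisson_singleton_zero]
  constructor
  · intro h
    have := (EReal.one_le_exp_iff).1 h.ge
    have hm : (m : EReal) ≤ 0 := by simpa using this
    exact le_antisymm (by exact_mod_cast hm) bot_le
  · rintro rfl; simp

/-- A count almost surely equal to 1 would never be 0, which forces `m = ∞`; but then the count is
infinite. -/
lemma extendedPoisson_compl_one_ne_zero (m : ℝ≥0∞) : extendedPoisson m {1}ᶜ ≠ 0 := by
  intro h
  by_cases hm : m = ∞
  · simp [extendedPoisson, hm] at h
  · have h0 : extendedPoisson m {0} = 0 := measure_mono_null (by simp) h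
    rw [extendedPoisson_singleton_zero, exp_neg_coe_ennreal_eq_zero] at h0
    exact hm h0

lemma extendedPoisson_compl_zero_one_eq_zero {m : ℝ≥0∞} (h : extendedPoisson m {0, 1}ᶜ = 0) :
    m = 0 := by
  by_cases hm : m = ∞
  · simp [extendedPoisson, hm] at h
  have h2 : extendedPoisson m {((2 : ℕ) : ℝ≥0∞)} = 0 := measure_mono_null (by simp) h
  rw [extendedPoisson_singleton_natCast hm, ENNReal.ofReal_eq_zero] at h2
  by_contra h0
  have : 0 < m.toReal := ENNReal.toReal_pos h0 hm
  have : 0 < Real.exp (-m.toReal) * m.toReal ^ 2 / ((2 : ℕ).factorial : ℝ) := by positivity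
  linarith

end ExtendedPoisson

/-! ### Point measures, their atoms and their maximum -/

section PointMeasure

variable {T : Type*} [TopologicalSpace T] [CompactSpace T]

lemma apply_nonneg (f : C0 T) (t : T) : 0 ≤ f.1 t := f.2.1 t

lemma apply_le_norm (f : C0 T) (t : T) : f.1 t ≤ ‖f.1‖ := f.1.apply_le_norm t

lemma measurable_eval (t : T) : Measurable (fun f : C0 T => f.1 t) := by
  have : Continuous (fun f : C0 T => f.1 t) := (continuous_eval_const (F := C(T, ℝ)) t).comp
    continuous_subtype_val
  exact this.measurable

lemma measurable_norm_coe : Measurable (fun f : C0 T => ‖f.1‖) :=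
  (continuous_norm.comp continuous_subtype_val).measurable

lemma atoms_sum_dirac {I : Type} (f : I → C0 T) :
    atoms (Measure.sum fun i => Measure.dirac (f i)) = range f := by
  ext g
  simp only [atoms, mem_ofPred_eq, ne_eq, Measure.sum_apply _ (measurableSet_singleton g),
    Measure.dirac_apply' _ (measurableSet_singleton g), ENNReal.tsum_eq_zero, mem_range]
  simp

variable {M : Measure (C0 T)}

lemma measure_eq_zero_iff_atoms (hM : M ∈ pointMeasures T) {A : Set (C0 T)}
    (hA : MeasurableSet A) : M A = 0 ↔ ∀ g ∈ atoms M, g ∉ A := by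
  obtain ⟨I, f, -, rfl⟩ := hM
  rw [atoms_sum_dirac]
  simp only [Measure.sum_apply _ hA, Measure.dirac_apply' _ hA, ENNReal.tsum_eq_zero]
  simp

lemma one_le_measure_of_ne_zero (hM : M ∈ pointMeasures T) {A : Set (C0 T)}
    (hA : MeasurableSet A) (h : M A ≠ 0) : 1 ≤ M A := by
  obtain ⟨I, f, -, rfl⟩ := hM
  simp only [Measure.sum_apply _ hA, Measure.dirac_apply' _ hA] at h ⊢
  rw [ne_eq, ENNReal.tsum_eq_zero, not_forall] at h
  obtain ⟨i, hi⟩ := h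
  have : f i ∈ A := by by_contra h'; simp [h'] at hi
  exact le_trans (by simp [this]) (ENNReal.le_tsum i)

lemma measure_lt_norm_ne_top (hM : M ∈ pointMeasures T) {ε : ℝ} (hε : 0 < ε) :
    M {f | ε < ‖f.1‖} ≠ ∞ := by
  obtain ⟨I, f, hf, rfl⟩ := hM
  have hA : MeasurableSet {f : C0 T | ε < ‖f.1‖} := measurableSet_lt measurable_const
    measurable_norm_coe
  simp only [Measure.sum_apply _ hA, Measure.dirac_apply' _ hA]
  rw [tsum_eq_sum (s := (hf ε hε).toFinset)]
  · exact ENNReal.sum_ne_top.2 fun i _ => by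
      by_cases h : ε < ‖(f i).1‖ <;> simp [h]
  · intro i hi
    simpa [Set.indicator_apply] using hi

/-- Mass one means that exactly one index contributes: two indices, even with equal functions, would
already give mass two. -/
lemma exists_restrict_eq_dirac (hM : M ∈ pointMeasures T) {A : Set (C0 T)}
    (hA : MeasurableSet A) (h : M A = 1) : ∃ g, M.restrict A = Measure.dirac g := by
  classical
  obtain ⟨I, f, -, rfl⟩ := hM
  have h0 : (Measure.sum fun i => Measure.dirac (f i)) A ≠ 0 := by simp [h]
  simp only [Measure.sum_apply _ hA, Measure.dirac_apply' _ hA] at h h0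
  rw [ne_eq, ENNReal.tsum_eq_zero, not_forall] at h0
  obtain ⟨i, hi⟩ := h0
  have hiA : f i ∈ A := by by_contra h'; simp [h'] at hi
  have hother : ∀ j, j ≠ i → f j ∉ A := by
    intro j hj hjA
    have h2 : ∑ k ∈ ({i, j} : Finset I), A.indicator (1 : C0 T → ℝ≥0∞) (f k) ≤ 1 :=
      h ▸ ENNReal.sum_le_tsum _
    rw [Finset.sum_pair hj.symm] at h2
    simp only [indicator_of_mem hiA, indicator_of_mem hjA, Pi.one_apply] at h2
    norm_num at h2
  refine ⟨f i, ?_⟩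
  ext B hB
  rw [Measure.restrict_apply hB, Measure.sum_apply _ (hB.inter hA), tsum_eq_single i]
  · rw [Measure.dirac_apply' _ hB, Measure.dirac_apply' _ (hB.inter hA)]
    simp [Set.indicator_apply, hiA]
  · intro j hj
    rw [Measure.dirac_apply' _ (hB.inter hA), indicator_of_notMem]
    exact fun h' => hother j hj h'.2

lemma finite_atoms_lt_norm (hM : M ∈ pointMeasures T) {ε : ℝ} (hε : 0 < ε) :
    {g ∈ atoms M | ε < ‖g.1‖}.Finite := by
  obtain ⟨I, f, hf, rfl⟩ := hM
  rw [atoms_sum_dirac]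
  refine ((hf ε hε).image f).subset ?_
  rintro _ ⟨⟨i, rfl⟩, hi⟩
  exact ⟨i, hi, rfl⟩

lemma bddAbove_eval_atoms (hM : M ∈ pointMeasures T) (t : T) :
    BddAbove ((fun f : C0 T => f.1 t) '' atoms M) := by
  obtain ⟨b, hb⟩ := ((finite_atoms_lt_norm hM one_pos).image fun f => f.1 t).bddAbove
  refine ⟨max b 1, ?_⟩
  rintro _ ⟨g, hg, rfl⟩
  by_cases h : 1 < ‖g.1‖
  · exact le_max_of_le_left (hb ⟨g, ⟨hg, h⟩, rfl⟩)
  · exact le_max_of_le_right ((apply_le_norm g t).trans (not_lt.1 h))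

lemma le_maxFun (hM : M ∈ pointMeasures T) (t : T) {g : C0 T} (hg : g ∈ atoms M) :
    g.1 t ≤ maxFun M t :=
  le_csSup (bddAbove_eval_atoms hM t) ⟨g, hg, rfl⟩

lemma maxFun_nonneg (M : Measure (C0 T)) (t : T) : 0 ≤ maxFun M t := by
  refine Real.sSup_nonneg ?_
  rintro _ ⟨g, -, rfl⟩
  exact apply_nonneg g t

/-- Only finitely many atoms have norm above half the supremum, and the others cannot compete, so
the supremum is a finite maximum. -/
lemma exists_atom_eq_maxFun (hM : M ∈ pointMeasures T) {t : T} (h : 0 < maxFun M t) :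
    ∃ g ∈ atoms M, g.1 t = maxFun M t := by
  set S := {g ∈ atoms M | maxFun M t / 2 < ‖g.1‖} with hS
  have hfin : S.Finite := finite_atoms_lt_norm hM (half_pos h)
  have hne : ((fun f : C0 T => f.1 t) '' atoms M).Nonempty := by
    by_contra h'
    rw [not_nonempty_iff_eq_empty] at h'
    simp [maxFun, h'] at h
  obtain ⟨_, ⟨g, hg, rfl⟩, hgt⟩ := exists_lt_of_lt_csSup hne
    (show maxFun M t / 2 < sSup _ from half_lt_self h)
  have hgS : g ∈ S := ⟨hg, hgt.trans_le (apply_le_norm g t)⟩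
  obtain ⟨k, hk, hmax⟩ := hfin.exists_maximalFor (fun f : C0 T => f.1 t) S ⟨g, hgS⟩
  have hmax' : ∀ j ∈ S, j.1 t ≤ k.1 t := fun j hj => by
    by_contra hlt
    exact hlt (hmax hj (not_le.1 hlt).le)
  refine ⟨k, hk.1, le_antisymm (le_maxFun hM t hk.1) (csSup_le hne ?_)⟩
  rintro _ ⟨j, hj, rfl⟩
  by_cases hjS : j ∈ S
  · exact hmax' j hjS
  · have : ‖j.1‖ ≤ maxFun M t / 2 := by
      by_contra hlt
      exact hjS ⟨hj, not_le.1 hlt⟩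
    exact ((apply_le_norm j t).trans this).trans (hgt.le.trans (hmax' g hgS))

lemma measurableSet_le_eval (t : T) (x : ℝ) : MeasurableSet {f : C0 T | x ≤ f.1 t} :=
  measurableSet_le measurable_const (measurable_eval t)

lemma measurableSet_lt_eval (t : T) (x : ℝ) : MeasurableSet {f : C0 T | x < f.1 t} :=
  measurableSet_lt measurable_const (measurable_eval t)

lemma measure_lt_eval_eq_zero_iff (hM : M ∈ pointMeasures T) {t : T} {x : ℝ} (hx : 0 ≤ x) :
    M {f | x < f.1 t} = 0 ↔ maxFun M t ≤ x := by
  rw [measure_eq_zero_iff_atoms hM (measurableSet_lt_eval t x)]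
  constructor
  · intro h
    by_contra hlt
    rw [not_le] at hlt
    obtain ⟨g, hg, hgt⟩ := exists_atom_eq_maxFun hM (hx.trans_lt hlt)
    exact h g hg (hlt.trans_eq hgt.symm)
  · exact fun h g hg hlt => absurd (le_maxFun hM t hg) (not_le.2 (h.trans_lt hlt))

end PointMeasure

/-! ### Probabilities of counts, and finiteness of the intensity away from zero -/

section Poisson

variable {T : Type*} [TopologicalSpace T] [CompactSpace T] {Ω : Type*} [MeasurableSpace Ω]
  {P : Measure Ω} {μ : Measure (C0 T)} {Φ : Ω → Measure (C0 T)}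

namespace IsPoissonRandomMeasure

lemma measurable_apply (h : IsPoissonRandomMeasure P μ Φ) {A : Set (C0 T)}
    (hA : MeasurableSet A) : Measurable fun ω => Φ ω A :=
  (Measure.measurable_coe hA).comp h.measurable

lemma measurableSet_apply_mem (h : IsPoissonRandomMeasure P μ Φ) {A : Set (C0 T)}
    (hA : MeasurableSet A) {S : Set ℝ≥0∞} (hS : MeasurableSet S) :
    MeasurableSet {ω | Φ ω A ∈ S} :=
  h.measurable_apply hA hS

lemma measure_mem (h : IsPoissonRandomMeasure P μ Φ) {A : Set (C0 T)}
    (hA : MeasurableSet A) {S : Set ℝ≥0∞} (hS : MeasurableSet S) :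
    P {ω | Φ ω A ∈ S} = extendedPoisson (μ A) S :=
  (h.hasLaw A hA).measure_eq (p := (· ∈ S)) hS

lemma measure_mem_and_mem (h : IsPoissonRandomMeasure P μ Φ) {A B : Set (C0 T)}
    (hA : MeasurableSet A) (hB : MeasurableSet B) (hAB : Disjoint A B) {S R : Set ℝ≥0∞}
    (hS : MeasurableSet S) (hR : MeasurableSet R) :
    P {ω | Φ ω A ∈ S ∧ Φ ω B ∈ R} = extendedPoisson (μ A) S * extendedPoisson (μ B) R := by
  have hi := h.indep 2 ![A, B] (by intro i; fin_cases i <;> assumption) (by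
    intro i j hij
    fin_cases i <;> fin_cases j <;> simp_all [hAB.symm])
  have := (hi.indepFun (i := 0) (j := 1) (by decide)).measure_inter_preimage_eq_mul S R hS hR
  rw [← h.measure_mem hA hS, ← h.measure_mem hB hR]
  exact this

/-- Infinite intensity would make the count almost surely infinite, whereas point measures have
finite counts here. -/
lemma measure_lt_norm_ne_top [IsProbabilityMeasure P] (h : IsPoissonRandomMeasure P μ Φ)
    {ε : ℝ} (hε : 0 < ε) :
    μ {f | ε < ‖f.1‖} ≠ ∞ := by
  intro htop
  have hA : MeasurableSet {f : C0 T | ε < ‖f.1‖} := measurableSet_lt measurable_const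
    measurable_norm_coe
  have h1 := h.measure_mem hA (measurableSet_singleton ∞)
  have h2 : {ω | Φ ω {f | ε < ‖f.1‖} ∈ ({∞} : Set ℝ≥0∞)} = ∅ := by
    ext ω
    simpa using MaxID.measure_lt_norm_ne_top (h.mem_pointMeasures ω) hε
  rw [h2, htop] at h1
  simp [extendedPoisson] at h1

lemma measure_le_eval_ne_top [IsProbabilityMeasure P] (h : IsPoissonRandomMeasure P μ Φ)
    (t : T) {x : ℝ} (hx : 0 < x) : μ {f | x ≤ f.1 t} ≠ ∞ := by
  refine ne_top_of_le_ne_top (h.measure_lt_norm_ne_top (half_pos hx)) (measure_mono ?_)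
  intro f hf
  exact (half_lt_self hx).trans_le (le_trans hf (apply_le_norm f t))

end IsPoissonRandomMeasure

end Poisson

end MaxID

namespace MaxID

/-! ### The tail function and its continuity -/

section Tail

variable {T : Type*} [TopologicalSpace T] [CompactSpace T] {μ : Measure (C0 T)} {t : T}

lemma tail_eq (μ : Measure (C0 T)) (t : T) (x : ℝ) :
    tail μ t x = μ {f | x ≤ f.1 t ∧ 0 < f.1 t} := by
  rw [tail, evalMeasure, Measure.restrict_apply measurableSet_Ici,
    Measure.map_apply (measurable_eval t) (measurableSet_Ici.inter measurableSet_Ioi)]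
  rfl

lemma tail_of_pos {x : ℝ} (hx : 0 < x) : tail μ t x = μ {f | x ≤ f.1 t} := by
  rw [tail_eq]
  congr 1
  ext f
  exact ⟨fun h => h.1, fun h => ⟨h, hx.trans_le h⟩⟩

lemma tail_zero : tail μ t 0 = μ {f | 0 < f.1 t} := by
  rw [tail_eq]
  congr 1
  ext f
  exact ⟨fun h => h.2, fun h => ⟨le_of_lt h, h⟩⟩

lemma tail_antitone (μ : Measure (C0 T)) (t : T) : Antitone (tail μ t) :=
  fun _ _ h => measure_mono (Ici_subset_Ici.2 h)

lemma tendsto_tail_nhdsGT (μ : Measure (C0 T)) (t : T) {x : ℝ} (hx : 0 ≤ x) :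
    Tendsto (tail μ t) (𝓝[>] x) (𝓝 (μ {f | x < f.1 t})) := by
  have h1 := (tail_antitone μ t).tendsto_nhdsGT x
  have h2 : Tendsto (fun n : ℕ => x + 1 / ((n : ℝ) + 1)) atTop (𝓝[>] x) := by
    refine tendsto_nhdsWithin_iff.2 ⟨?_, Eventually.of_forall fun n => ?_⟩
    · simpa using tendsto_const_nhds.add (tendsto_one_div_add_atTop_nhds_zero_nat (𝕜 := ℝ))
    · have : (0 : ℝ) < 1 / ((n : ℝ) + 1) := by positivity
      simpa using this
  have h3 : Tendsto (fun n : ℕ => tail μ t (x + 1 / ((n : ℝ) + 1))) atTop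
      (𝓝 (μ (⋃ n : ℕ, {f | x + 1 / ((n : ℝ) + 1) ≤ f.1 t}))) := by
    have hmono : Monotone fun n : ℕ => {f : C0 T | x + 1 / ((n : ℝ) + 1) ≤ f.1 t} := by
      intro n m hnm f hf
      have : 1 / ((m : ℝ) + 1) ≤ 1 / ((n : ℝ) + 1) := one_div_le_one_div_of_le (by positivity)
        (by exact_mod_cast Nat.succ_le_succ hnm)
      exact (add_le_add_right this x).trans hf
    refine (tendsto_measure_iUnion_atTop hmono).congr fun n => ?_
    rw [tail_of_pos (by positivity)]
    rfl
  have h4 : (⋃ n : ℕ, {f : C0 T | x + 1 / ((n : ℝ) + 1) ≤ f.1 t}) = {f | x < f.1 t} := by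
    ext f
    simp only [mem_iUnion, mem_ofPred_eq]
    constructor
    · rintro ⟨n, hn⟩
      have : (0 : ℝ) < 1 / ((n : ℝ) + 1) := by positivity
      linarith
    · intro h
      obtain ⟨n, hn⟩ := exists_nat_one_div_lt (sub_pos.2 h)
      exact ⟨n, by linarith⟩
  rw [← h4, ← tendsto_nhds_unique (h1.comp h2) h3]
  exact h1

lemma measure_le_eval_eq_add (μ : Measure (C0 T)) (t : T) (x : ℝ) :
    μ {f | x ≤ f.1 t} = μ {f | f.1 t = x} + μ {f | x < f.1 t} := by
  rw [← measure_union _ (measurableSet_lt_eval t x)]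
  · congr 1
    ext f
    simp only [mem_ofPred_eq, mem_union]
    rw [le_iff_eq_or_lt, eq_comm]
  · rw [Set.disjoint_left]
    exact fun f (h : f.1 t = x) (h' : x < f.1 t) => absurd h h'.ne'

/-- The value of the tail at `x` exceeds its right limit by the mass of `{f(t) = x}`; finiteness
allows the cancellation. Conversely, without such mass the indicators converge almost everywhere and
dominated convergence applies. -/
lemma tail_continuousOn_iff (hfin : ∀ x : ℝ, 0 < x → μ {f | x ≤ f.1 t} ≠ ∞) :
    ContinuousOn (tail μ t) (Ioi 0) ↔ ∀ x : ℝ, 0 < x → μ {f | f.1 t = x} = 0 := by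
  constructor
  · intro h x hx
    have hc := (h.continuousAt (Ioi_mem_nhds hx)).tendsto.mono_left
      (nhdsWithin_le_nhds (s := Ioi x))
    have he := tendsto_nhds_unique hc (tendsto_tail_nhdsGT μ t hx.le)
    rw [tail_of_pos hx, measure_le_eval_eq_add] at he
    refine (ENNReal.add_left_inj (c := 0) (a := μ {f | x < f.1 t}) ?_).1 (by rw [he, zero_add])
    exact ne_top_of_le_ne_top (hfin x hx) (measure_mono fun f (hf : x < f.1 t) => hf.le)
  · intro h x hx
    rw [mem_Ioi] at hx
    refine ContinuousAt.continuousWithinAt ?_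
    -- A single set of finite measure containing `{f(t) ≥ y}` for all `y` near `x`, so that the
    -- constant 1 is an integrable bound.
    set S := {f : C0 T | x / 2 ≤ f.1 t} with hS
    have hev : ∀ᶠ y in 𝓝 x, tail μ t y =
        ∫⁻ f in S, {f : C0 T | y ≤ f.1 t}.indicator 1 f ∂μ := by
      filter_upwards [Ioi_mem_nhds (half_lt_self hx)] with y hy
      rw [mem_Ioi] at hy
      rw [lintegral_indicator_one (measurableSet_le_eval t y),
        Measure.restrict_apply (measurableSet_le_eval t y), tail_of_pos ((half_pos hx).trans hy)]
      congr 1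
      ext f
      exact ⟨fun hf => ⟨hf, hy.le.trans hf⟩, fun hf => hf.1⟩
    rw [ContinuousAt, hev.self_of_nhds]
    refine Tendsto.congr' (hev.mono fun y hy => hy.symm) ?_
    refine tendsto_lintegral_filter_of_dominated_convergence 1
      (Eventually.of_forall fun y => measurable_one.indicator (measurableSet_le_eval t y))
      (Eventually.of_forall fun y => Eventually.of_forall fun f => indicator_le_self _ _ f)
      (by simpa using hfin _ (half_pos hx)) ?_
    have hne : ∀ᵐ f : C0 T ∂μ.restrict S, f.1 t ≠ x := by
      refine ae_restrict_of_ae ?_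
      rw [ae_iff]
      simpa using h x hx
    filter_upwards [hne] with f hf
    refine tendsto_const_nhds.congr' ?_
    rcases lt_or_gt_of_ne hf with hlt | hgt
    · filter_upwards [Ioi_mem_nhds hlt] with y hy
      rw [mem_Ioi] at hy
      simp [not_le.2 hlt, not_le.2 hy]
    · filter_upwards [Iio_mem_nhds hgt] with y hy
      rw [mem_Iio] at hy
      simp [hgt.le, hy.le]

/-- The density `x ↦ exp(-μ_t[x, ∞))`. -/
noncomputable def expTail (μ : Measure (C0 T)) (t : T) (x : ℝ) : ℝ≥0∞ :=
  EReal.exp (-(tail μ t x : EReal))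

lemma expTail_le_one (x : ℝ) : expTail μ t x ≤ 1 := exp_neg_coe_ennreal_le_one _

lemma continuousAt_expTail (h : ContinuousOn (tail μ t) (Ioi 0)) {x : ℝ} (hx : 0 < x) :
    ContinuousAt (expTail μ t) x := by
  have hc : Continuous fun m : ℝ≥0∞ => EReal.exp (-(m : EReal)) :=
    ENNReal.continuous_exp.comp (continuous_neg.comp continuous_coe_ennreal_ereal)
  exact hc.continuousAt.comp (h.continuousAt (Ioi_mem_nhds hx))

lemma expTail_zero (h : μ {f | 0 < f.1 t} = ∞) : expTail μ t 0 = 0 := by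
  rw [expTail, tail_zero, h]
  simp

end Tail

end MaxID

namespace MaxID

/-! ### Discretization of the value at `t` -/

section Grid

variable {T : Type*} [TopologicalSpace T] [CompactSpace T] {μ : Measure (C0 T)} {t : T}

/-- The functions whose value at `t` lies in `[k / (n + 1), (k + 1) / (n + 1))`. -/
def cell (t : T) (n k : ℕ) : Set (C0 T) := {f | ⌊f.1 t * ((n : ℝ) + 1)⌋₊ = k}

lemma mem_cell_iff {n k : ℕ} {f : C0 T} :
    f ∈ cell t n k ↔ (k : ℝ) / ((n : ℝ) + 1) ≤ f.1 t ∧ f.1 t < ((k : ℝ) + 1) / ((n : ℝ) + 1) := by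
  have hn : (0 : ℝ) < (n : ℝ) + 1 := by positivity
  rw [cell, mem_ofPred_eq, Nat.floor_eq_iff (mul_nonneg (apply_nonneg f t) hn.le),
    div_le_iff₀ hn, lt_div_iff₀ hn]

lemma measurable_floor_eval (t : T) (n : ℕ) :
    Measurable fun f : C0 T => ⌊f.1 t * ((n : ℝ) + 1)⌋₊ :=
  Nat.measurable_floor.comp ((measurable_eval t).mul_const _)

lemma measurableSet_cell (t : T) (n k : ℕ) : MeasurableSet (cell t n k) :=
  measurable_floor_eval t n (measurableSet_singleton k)

lemma lintegral_floor_eval (n : ℕ) {A : Set (C0 T)} (hA : MeasurableSet A) (F : ℕ → ℝ≥0∞) :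
    ∫⁻ f in A, F ⌊f.1 t * ((n : ℝ) + 1)⌋₊ ∂μ = ∑' k, μ (A ∩ cell t n k) * F k := by
  have hU : A = ⋃ k, A ∩ cell t n k := by
    rw [← inter_iUnion]
    exact (inter_eq_left.2 fun f _ => mem_iUnion.2 ⟨⌊f.1 t * ((n : ℝ) + 1)⌋₊, rfl⟩).symm
  have hm : ∀ k, MeasurableSet (A ∩ cell t n k) := fun k => hA.inter (measurableSet_cell t n k)
  conv_lhs => rw [hU]
  rw [lintegral_iUnion hm]
  · refine tsum_congr fun k => ?_
    rw [setLIntegral_congr_fun (g := fun _ => F k) (hm k), setLIntegral_const, mul_comm]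
    intro f hf
    have : ⌊f.1 t * ((n : ℝ) + 1)⌋₊ = k := hf.2
    simp only [this]
  · intro i j hij
    refine Set.disjoint_left.2 fun f hi hj => hij ?_
    exact Eq.trans (Eq.symm hi.2) hj.2

lemma tendsto_natCast_add_one_atTop : Tendsto (fun n : ℕ => (n : ℝ) + 1) atTop atTop :=
  tendsto_atTop_add_const_right _ _ tendsto_natCast_atTop_atTop

lemma tendsto_floor_grid {y : ℝ} (hy : 0 ≤ y) :
    Tendsto (fun n : ℕ => (⌊y * ((n : ℝ) + 1)⌋₊ : ℝ) / ((n : ℝ) + 1)) atTop (𝓝 y) :=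
  (tendsto_nat_floor_mul_div_atTop hy).comp tendsto_natCast_add_one_atTop

lemma tendsto_floor_add_one_grid {y : ℝ} (hy : 0 ≤ y) :
    Tendsto (fun n : ℕ => ((⌊y * ((n : ℝ) + 1)⌋₊ : ℝ) + 1) / ((n : ℝ) + 1)) atTop (𝓝 y) := by
  simpa [add_div] using
    (tendsto_floor_grid hy).add (tendsto_one_div_add_atTop_nhds_zero_nat (𝕜 := ℝ))

variable {Ω : Type*} [MeasurableSpace Ω] {P : Measure Ω} {Φ : Ω → Measure (C0 T)}

/-- The event that, among the atoms of `Φ` with value at `t` at least `k / (n + 1)`, there is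
exactly one, which moreover lies in `A` and in the cell of index `k`. -/
def isolatedMaxEvent (Φ : Ω → Measure (C0 T)) (t : T) (A : Set (C0 T)) (n k : ℕ) : Set Ω :=
  {ω | Φ ω (A ∩ cell t n k) ∈ ({1} : Set ℝ≥0∞) ∧
    Φ ω (cell t n k \ A ∪ {f | ((k : ℝ) + 1) / ((n : ℝ) + 1) ≤ f.1 t}) ∈ ({0} : Set ℝ≥0∞)}

lemma measurableSet_sdiff_cell_union {A : Set (C0 T)} (hA : MeasurableSet A) (n k : ℕ) :
    MeasurableSet (cell t n k \ A ∪ {f | ((k : ℝ) + 1) / ((n : ℝ) + 1) ≤ f.1 t}) :=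
  ((measurableSet_cell t n k).diff hA).union (measurableSet_le_eval t _)

lemma disjoint_inter_cell (A : Set (C0 T)) (n k : ℕ) : Disjoint (A ∩ cell t n k)
    (cell t n k \ A ∪ {f | ((k : ℝ) + 1) / ((n : ℝ) + 1) ≤ f.1 t}) := by
  refine Set.disjoint_left.2 ?_
  rintro f ⟨hfA, hfc⟩ (⟨-, h⟩ | h)
  · exact h hfA
  · exact absurd h (not_le.2 (mem_cell_iff.1 hfc).2)

lemma inter_cell_union (A : Set (C0 T)) (n k : ℕ) : (A ∩ cell t n k) ∪
    (cell t n k \ A ∪ {f | ((k : ℝ) + 1) / ((n : ℝ) + 1) ≤ f.1 t}) =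
      {f | (k : ℝ) / ((n : ℝ) + 1) ≤ f.1 t} := by
  have hle : (k : ℝ) / ((n : ℝ) + 1) ≤ ((k : ℝ) + 1) / ((n : ℝ) + 1) := by gcongr; linarith
  ext f
  simp only [mem_union, mem_inter_iff, Set.mem_sdiff, mem_cell_iff, mem_ofPred_eq]
  constructor
  · rintro (⟨-, h, -⟩ | ⟨⟨h, -⟩, -⟩ | h)
    exacts [h, h, hle.trans h]
  · intro h
    by_cases h1 : f.1 t < ((k : ℝ) + 1) / ((n : ℝ) + 1)
    · by_cases hA : f ∈ A
      · exact Or.inl ⟨hA, h, h1⟩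
      · exact Or.inr (Or.inl ⟨⟨h, h1⟩, hA⟩)
    · exact Or.inr (Or.inr (not_lt.1 h1))

lemma extremalMeasure_singleton (M : Measure (C0 T)) (g : C(T, ℝ)) (t : T) :
    extremalMeasure M g {t} = M.restrict {f | g t ≤ f.1 t} := by
  rw [extremalMeasure]
  congr 1
  ext f
  simp [LtOn]

/-- The maximum is at least `k/(n+1)`, and only one atom, lying in `A`, reaches that level; it must
therefore be the unique extremal one. -/
lemma extremalMeasure_of_mem_isolatedMaxEvent {A : Set (C0 T)} (hA : MeasurableSet A)
    {n k : ℕ} {ω : Ω} (hM : Φ ω ∈ pointMeasures T) {g : C(T, ℝ)} (hg : g t = maxFun (Φ ω) t)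
    (hω : ω ∈ isolatedMaxEvent Φ t A n k) :
    extremalMeasure (Φ ω) g {t} univ = 1 ∧ extremalMeasure (Φ ω) g {t} A = 1 := by
  obtain ⟨h1, h0⟩ := hω
  rw [mem_singleton_iff] at h1 h0
  set M := Φ ω
  have hB := hA.inter (measurableSet_cell t n k)
  have hC := measurableSet_sdiff_cell_union (t := t) hA n k
  have hS : MeasurableSet {f : C0 T | maxFun M t ≤ f.1 t} := measurableSet_le_eval t _
  have hexists : ∃ f ∈ atoms M, f ∈ A ∩ cell t n k := by
    by_contra! h
    rw [(measure_eq_zero_iff_atoms hM hB).2 h] at h1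
    exact zero_ne_one h1
  obtain ⟨f, hf, hfB⟩ := hexists
  have hge : (k : ℝ) / ((n : ℝ) + 1) ≤ maxFun M t :=
    (mem_cell_iff.1 hfB.2).1.trans (le_maxFun hM t hf)
  have hle : M {f : C0 T | maxFun M t ≤ f.1 t} ≤ 1 := by
    calc M {f : C0 T | maxFun M t ≤ f.1 t}
        ≤ M {f | (k : ℝ) / ((n : ℝ) + 1) ≤ f.1 t} := measure_mono fun f hf => hge.trans hf
      _ ≤ 1 := by
        rw [← inter_cell_union A n k]
        refine (measure_union_le _ _).trans ?_
        rw [h1, h0, add_zero]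
  have hne : M (A ∩ {f : C0 T | maxFun M t ≤ f.1 t}) ≠ 0 := by
    intro h
    rw [measure_eq_zero_iff_atoms hM (hA.inter hS)] at h
    rcases (maxFun_nonneg M t).eq_or_lt with h' | h'
    -- When the maximum is 0 it need not come from `exists_atom_eq_maxFun`, but every atom attains
    -- it, in particular `f`.
    · exact h f hf ⟨hfB.1, h' ▸ apply_nonneg f t⟩
    · obtain ⟨f', hf', hf't⟩ := exists_atom_eq_maxFun hM h'
      refine h f' hf' ⟨?_, hf't.ge⟩
      have hmem : f' ∈ {f : C0 T | (k : ℝ) / ((n : ℝ) + 1) ≤ f.1 t} := hge.trans hf't.ge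
      rw [← inter_cell_union A n k] at hmem
      rcases hmem with hmem | hmem
      · exact hmem.1
      · exact absurd hmem ((measure_eq_zero_iff_atoms hM hC).1 h0 f' hf')
  have hge1 := one_le_measure_of_ne_zero hM (hA.inter hS) hne
  rw [extremalMeasure_singleton, hg, Measure.restrict_apply .univ, univ_inter,
    Measure.restrict_apply hA]
  exact ⟨le_antisymm hle (hge1.trans (measure_mono inter_subset_right)),
    le_antisymm ((measure_mono inter_subset_right).trans hle) hge1⟩

/-- For `j < k`, the event of index `j` forbids atoms at level `(j+1)/(n+1)` or above, hence in cell
`k`, where the event of index `k` requires one. -/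
lemma pairwise_disjoint_isolatedMaxEvent (Φ : Ω → Measure (C0 T)) (t : T) (A : Set (C0 T))
    (n : ℕ) : Pairwise (Function.onFun Disjoint (isolatedMaxEvent Φ t A n)) := by
  refine (pairwise_disjoint_on _).2 fun j k hjk => ?_
  refine Set.disjoint_left.2 fun ω hj hk => ?_
  have h1 : Φ ω (A ∩ cell t n k) = 1 := hk.1
  have h0 : Φ ω (A ∩ cell t n k) = 0 := by
    refine measure_mono_null (fun f hf => Or.inr ?_) hj.2
    refine le_trans ?_ (mem_cell_iff.1 hf.2).1
    gcongr
    exact_mod_cast hjk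
  rw [h0] at h1
  exact zero_ne_one h1

namespace IsPoissonRandomMeasure

lemma measurableSet_isolatedMaxEvent (h : IsPoissonRandomMeasure P μ Φ) {A : Set (C0 T)}
    (hA : MeasurableSet A) (n k : ℕ) : MeasurableSet (isolatedMaxEvent Φ t A n k) :=
  (h.measurableSet_apply_mem (hA.inter (measurableSet_cell t n k)) (measurableSet_singleton 1)).inter
    (h.measurableSet_apply_mem (measurableSet_sdiff_cell_union hA n k) (measurableSet_singleton 0))

variable [IsProbabilityMeasure P]

lemma le_measure_isolatedMaxEvent (h : IsPoissonRandomMeasure P μ Φ)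
    (hinf : μ {f | 0 < f.1 t} = ∞) {A : Set (C0 T)} (hA : MeasurableSet A) (n k : ℕ) :
    μ (A ∩ cell t n k) * expTail μ t ((k : ℝ) / ((n : ℝ) + 1)) ≤
      P (isolatedMaxEvent Φ t A n k) := by
  -- Cell 0 may have infinite mass, but its weight is `exp(-∞) = 0`. For `k > 0` the bound is an
  -- equality.
  rcases Nat.eq_zero_or_pos k with rfl | hk
  · simp [expTail_zero hinf]
  have hx : 0 < (k : ℝ) / ((n : ℝ) + 1) := by positivity
  have hB := hA.inter (measurableSet_cell t n k)
  have hC := measurableSet_sdiff_cell_union (t := t) hA n k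
  have hBfin : μ (A ∩ cell t n k) ≠ ∞ :=
    ne_top_of_le_ne_top (h.measure_le_eval_ne_top t hx)
      (measure_mono fun f hf => (mem_cell_iff.1 hf.2).1)
  refine le_of_eq ?_
  rw [isolatedMaxEvent, h.measure_mem_and_mem hB hC (disjoint_inter_cell A n k)
    (measurableSet_singleton 1) (measurableSet_singleton 0), extendedPoisson_singleton_one hBfin,
    extendedPoisson_singleton_zero, mul_assoc, ← exp_neg_coe_ennreal_add,
    ← measure_union (disjoint_inter_cell A n k) hC, inter_cell_union, expTail, tail_of_pos hx]

/-- The sum over cells is the integral of the density rounded down to the grid. As `A` may have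
infinite measure, Fatou replaces dominated convergence, and it suffices that one `n` beats each
eventual lower bound. -/
lemma lintegral_expTail_le (h : IsPoissonRandomMeasure P μ Φ)
    (hinf : μ {f | 0 < f.1 t} = ∞) (hcont : ContinuousOn (tail μ t) (Ioi 0))
    {A : Set (C0 T)} (hA : MeasurableSet A) :
    ∫⁻ f in A, expTail μ t (f.1 t) ∂μ ≤ P (⋃ (n) (k), isolatedMaxEvent Φ t A n k) := by
  calc ∫⁻ f in A, expTail μ t (f.1 t) ∂μ
      ≤ ∫⁻ f in A, liminf (fun n : ℕ =>
          expTail μ t ((⌊f.1 t * ((n : ℝ) + 1)⌋₊ : ℝ) / ((n : ℝ) + 1))) atTop ∂μ := by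
        refine lintegral_mono fun f => ?_
        rcases (apply_nonneg f t).eq_or_lt with h0 | h0
        · simp only [← h0, expTail_zero hinf, zero_le]
        · exact ((continuousAt_expTail hcont h0).tendsto.comp
            (tendsto_floor_grid h0.le)).liminf_eq.ge
    _ ≤ liminf (fun n : ℕ => ∫⁻ f in A,
          expTail μ t ((⌊f.1 t * ((n : ℝ) + 1)⌋₊ : ℝ) / ((n : ℝ) + 1)) ∂μ) atTop :=
        lintegral_liminf_le fun n => (measurable_from_nat (f := fun k : ℕ =>
          expTail μ t ((k : ℝ) / ((n : ℝ) + 1)))).comp (measurable_floor_eval t n)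
    _ ≤ P (⋃ (n) (k), isolatedMaxEvent Φ t A n k) := by
        refine liminf_le_of_le (by isBoundedDefault) fun b hb => ?_
        obtain ⟨n, hn⟩ := hb.exists
        refine hn.trans ?_
        rw [lintegral_floor_eval n hA (fun k => expTail μ t ((k : ℝ) / ((n : ℝ) + 1)))]
        calc ∑' k, μ (A ∩ cell t n k) * expTail μ t ((k : ℝ) / ((n : ℝ) + 1))
            ≤ ∑' k, P (isolatedMaxEvent Φ t A n k) :=
              ENNReal.tsum_le_tsum fun k => h.le_measure_isolatedMaxEvent hinf hA n k
          _ = P (⋃ k, isolatedMaxEvent Φ t A n k) :=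
              (measure_iUnion (pairwise_disjoint_isolatedMaxEvent Φ t A n)
                fun k => h.measurableSet_isolatedMaxEvent hA n k).symm
          _ ≤ _ := measure_mono (subset_iUnion
              (fun n => ⋃ k, isolatedMaxEvent Φ t A n k) n)

/-- If some atom reaches `a`, a maximal one lies in some cell with no atom above that cell. The
union bound gives the integral of the density rounded up to the grid, and `{f(t) ≥ a}` has finite
measure, so dominated convergence applies. -/
lemma measure_ne_zero_le_lintegral (h : IsPoissonRandomMeasure P μ Φ)
    (hcont : ContinuousOn (tail μ t) (Ioi 0)) {a : ℝ} (ha : 0 < a) :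
    P {ω | Φ ω {f | a ≤ f.1 t} ∈ ({0}ᶜ : Set ℝ≥0∞)} ≤
      ∫⁻ f in {f | a ≤ f.1 t}, expTail μ t (f.1 t) ∂μ := by
  set A : Set (C0 T) := {f | a ≤ f.1 t} with hAdef
  have hA : MeasurableSet A := measurableSet_le_eval t a
  have hstep : ∀ n : ℕ, P {ω | Φ ω A ∈ ({0}ᶜ : Set ℝ≥0∞)} ≤ ∫⁻ f in A,
      expTail μ t (((⌊f.1 t * ((n : ℝ) + 1)⌋₊ : ℝ) + 1) / ((n : ℝ) + 1)) ∂μ := by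
    intro n
    rw [lintegral_floor_eval n hA (fun k => expTail μ t (((k : ℝ) + 1) / ((n : ℝ) + 1)))]
    have hsub : {ω | Φ ω A ∈ ({0}ᶜ : Set ℝ≥0∞)} ⊆
        ⋃ k : ℕ, {ω | Φ ω (A ∩ cell t n k) ∈ ({0}ᶜ : Set ℝ≥0∞) ∧
          Φ ω {f | ((k : ℝ) + 1) / ((n : ℝ) + 1) ≤ f.1 t} ∈ ({0} : Set ℝ≥0∞)} := by
      intro ω hω
      have hM := h.mem_pointMeasures ω
      have hω' : Φ ω A ≠ 0 := hω
      rw [ne_eq, measure_eq_zero_iff_atoms hM hA] at hω'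
      push Not at hω'
      obtain ⟨f, hf, hfA⟩ := hω'
      have hmax : a ≤ maxFun (Φ ω) t := le_trans hfA (le_maxFun hM t hf)
      obtain ⟨g, hg, hgt⟩ := exists_atom_eq_maxFun hM (ha.trans_le hmax)
      have hgc : g ∈ cell t n ⌊g.1 t * ((n : ℝ) + 1)⌋₊ := rfl
      refine mem_iUnion.2 ⟨⌊g.1 t * ((n : ℝ) + 1)⌋₊, ?_, (measure_eq_zero_iff_atoms hM (measurableSet_le_eval t _)).2 ?_⟩
      · exact fun h0 => (measure_eq_zero_iff_atoms hM (hA.inter (measurableSet_cell t n _))).1 h0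
          g hg ⟨hmax.trans hgt.ge, hgc⟩
      · exact fun f' hf' hle => absurd ((le_maxFun hM t hf').trans hgt.ge)
          (not_le.2 ((mem_cell_iff.1 hgc).2.trans_le hle))
    refine (measure_mono hsub).trans ((measure_iUnion_le _).trans
      (ENNReal.tsum_le_tsum fun k => ?_))
    have hdisj : Disjoint (A ∩ cell t n k) {f | ((k : ℝ) + 1) / ((n : ℝ) + 1) ≤ f.1 t} :=
      (disjoint_inter_cell A n k).mono_right subset_union_right
    rw [h.measure_mem_and_mem (hA.inter (measurableSet_cell t n k)) (measurableSet_le_eval t _)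
      hdisj (measurableSet_singleton 0).compl (measurableSet_singleton 0),
      extendedPoisson_singleton_zero, expTail, tail_of_pos (by positivity)]
    gcongr
    exact extendedPoisson_compl_zero_le _
  refine ge_of_tendsto' (tendsto_lintegral_of_dominated_convergence 1 (fun n => ?_)
    (fun n => Eventually.of_forall fun f => expTail_le_one _) ?_ ?_) hstep
  · exact (measurable_from_nat (f := fun k : ℕ =>
      expTail μ t (((k : ℝ) + 1) / ((n : ℝ) + 1)))).comp (measurable_floor_eval t n)
  · simpa using h.measure_le_eval_ne_top t ha
  · filter_upwards [ae_restrict_mem hA] with f hf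
    have hpos : 0 < f.1 t := ha.trans_le hf
    exact (continuousAt_expTail hcont hpos).tendsto.comp (tendsto_floor_add_one_grid hpos.le)

/-- Either some atom reaches level `a` or none does, so 1 is at most the integral plus `exp(-tail
a)`; the last term vanishes as `a ↓ 0`. -/
lemma one_le_lintegral_expTail (h : IsPoissonRandomMeasure P μ Φ)
    (hinf : Tendsto (tail μ t) (𝓝[>] 0) (𝓝 ∞)) (hcont : ContinuousOn (tail μ t) (Ioi 0)) :
    1 ≤ ∫⁻ f, expTail μ t (f.1 t) ∂μ := by
  have hlim : Tendsto (fun a => ∫⁻ f, expTail μ t (f.1 t) ∂μ + expTail μ t a) (𝓝[>] 0)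
      (𝓝 (∫⁻ f, expTail μ t (f.1 t) ∂μ + 0)) := by
    refine tendsto_const_nhds.add ?_
    have hc : Continuous fun m : ℝ≥0∞ => EReal.exp (-(m : EReal)) :=
      ENNReal.continuous_exp.comp (continuous_neg.comp continuous_coe_ennreal_ereal)
    have := (hc.tendsto ∞).comp hinf
    rwa [EReal.coe_ennreal_top, EReal.neg_top, EReal.exp_bot] at this
  rw [add_zero] at hlim
  refine ge_of_tendsto hlim ?_
  filter_upwards [self_mem_nhdsWithin] with a ha
  rw [mem_Ioi] at ha
  have hA : MeasurableSet {f : C0 T | a ≤ f.1 t} := measurableSet_le_eval t a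
  rw [expTail, tail_of_pos ha, ← extendedPoisson_singleton_zero,
    ← prob_add_prob_compl (μ := extendedPoisson (μ {f | a ≤ f.1 t})) (measurableSet_singleton 0),
    add_comm, ← h.measure_mem hA (measurableSet_singleton 0).compl]
  gcongr
  exact (h.measure_ne_zero_le_lintegral hcont ha).trans (setLIntegral_le_lintegral _ _)

end IsPoissonRandomMeasure

end Grid

end MaxID

namespace MaxID

/-! ### Atoms of the law of the maximum, and the extremal atom -/

section Extremal

variable {T : Type*} [TopologicalSpace T] [CompactSpace T] {μ : Measure (C0 T)} {t : T}
  {Ω : Type*} [MeasurableSpace Ω] {P : Measure Ω} [IsProbabilityMeasure P]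
  {Φ : Ω → Measure (C0 T)}

lemma measurableSet_eval_eq (t : T) (x : ℝ) : MeasurableSet {f : C0 T | f.1 t = x} :=
  measurable_eval t (measurableSet_singleton x)

lemma disjoint_eval_eq_lt (t : T) (x : ℝ) :
    Disjoint {f : C0 T | f.1 t = x} {f | x < f.1 t} :=
  Set.disjoint_left.2 fun _ h h' => absurd h (ne_of_gt h')

lemma tail_tendsto_top_iff :
    Tendsto (tail μ t) (𝓝[>] 0) (𝓝 ∞) ↔ μ {f | 0 < f.1 t} = ∞ :=
  ⟨fun h => tendsto_nhds_unique (tendsto_tail_nhdsGT μ t le_rfl) h,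
    fun h => h ▸ tendsto_tail_nhdsGT μ t le_rfl⟩

namespace IsPoissonRandomMeasure

lemma measure_maxFun_eq_zero (h : IsPoissonRandomMeasure P μ Φ) :
    P {ω | maxFun (Φ ω) t = 0} = EReal.exp (-(μ {f | 0 < f.1 t} : EReal)) := by
  rw [← extendedPoisson_singleton_zero, ← h.measure_mem (measurableSet_lt_eval t 0)
    (measurableSet_singleton 0)]
  congr 1
  ext ω
  change _ ↔ Φ ω _ = 0
  rw [measure_lt_eval_eq_zero_iff (h.mem_pointMeasures ω) le_rfl]
  exact ⟨fun h => h.le, fun h => le_antisymm h (maxFun_nonneg _ _)⟩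

lemma maxFun_eq_iff (h : IsPoissonRandomMeasure P μ Φ) (ω : Ω) {x : ℝ} (hx : 0 < x) :
    maxFun (Φ ω) t = x ↔ Φ ω {f | f.1 t = x} ≠ 0 ∧ Φ ω {f | x < f.1 t} = 0 := by
  have hM := h.mem_pointMeasures ω
  rw [measure_lt_eval_eq_zero_iff hM hx.le, ne_eq,
    measure_eq_zero_iff_atoms hM (measurableSet_eval_eq t x)]
  push Not
  constructor
  · intro he
    obtain ⟨g, hg, hgt⟩ := exists_atom_eq_maxFun hM (t := t) (he ▸ hx)
    exact ⟨⟨g, hg, hgt.trans he⟩, he.le⟩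
  · rintro ⟨⟨g, hg, hgt⟩, hle⟩
    exact le_antisymm hle (Eq.trans_le (Eq.symm hgt) (le_maxFun hM t hg))

lemma measure_maxFun_eq (h : IsPoissonRandomMeasure P μ Φ) {x : ℝ} (hx : 0 < x) :
    P {ω | maxFun (Φ ω) t = x} =
      extendedPoisson (μ {f | f.1 t = x}) {0}ᶜ * EReal.exp (-(μ {f | x < f.1 t} : EReal)) := by
  rw [← extendedPoisson_singleton_zero, ← h.measure_mem_and_mem (measurableSet_eval_eq t x)
    (measurableSet_lt_eval t x) (disjoint_eval_eq_lt t x) (measurableSet_singleton 0).compl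
    (measurableSet_singleton 0)]
  congr 1
  ext ω
  exact h.maxFun_eq_iff ω hx

lemma measure_lt_eval_ne_top (h : IsPoissonRandomMeasure P μ Φ) {x : ℝ} (hx : 0 < x) :
    μ {f | x < f.1 t} ≠ ∞ :=
  ne_top_of_le_ne_top (h.measure_le_eval_ne_top t hx) (measure_mono fun f (hf : x < f.1 t) => hf.le)

lemma tail_tendsto_top_and_continuousOn_iff (h : IsPoissonRandomMeasure P μ Φ) :
    (Tendsto (tail μ t) (𝓝[>] 0) (𝓝 ∞) ∧ ContinuousOn (tail μ t) (Ioi 0)) ↔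
      μ {f | 0 < f.1 t} = ∞ ∧ ∀ x : ℝ, 0 < x → μ {f | f.1 t = x} = 0 := by
  rw [tail_tendsto_top_iff, tail_continuousOn_iff fun x hx => h.measure_le_eval_ne_top t hx]

lemma forall_measure_maxFun_eq_zero_iff (h : IsPoissonRandomMeasure P μ Φ) :
    (∀ y : ℝ, P {ω | maxFun (Φ ω) t = y} = 0) ↔
      μ {f | 0 < f.1 t} = ∞ ∧ ∀ x : ℝ, 0 < x → μ {f | f.1 t = x} = 0 := by
  constructor
  · intro hP
    refine ⟨exp_neg_coe_ennreal_eq_zero.1 (h.measure_maxFun_eq_zero ▸ hP 0), fun x hx => ?_⟩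
    have := hP x
    rw [h.measure_maxFun_eq hx, mul_eq_zero, exp_neg_coe_ennreal_eq_zero] at this
    exact extendedPoisson_compl_zero_eq_zero.1 (this.resolve_right (h.measure_lt_eval_ne_top hx))
  · rintro ⟨h0, hx0⟩ y
    rcases lt_trichotomy y 0 with hy | rfl | hy
    · have : {ω | maxFun (Φ ω) t = y} = ∅ := by
        ext ω
        simpa using (hy.trans_le (maxFun_nonneg _ _)).ne'
      rw [this, measure_empty]
    · rw [h.measure_maxFun_eq_zero, h0, exp_neg_coe_ennreal_eq_zero]
    · rw [h.measure_maxFun_eq hy, extendedPoisson_compl_zero_eq_zero.2 (hx0 y hy), zero_mul]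

lemma measure_eval_eq_one_of_extremal {M : Measure (C0 T)} {g : C(T, ℝ)} {x : ℝ}
    (hg : g t = x) (hM : M {f | x < f.1 t} = 0) (h1 : extremalMeasure M g {t} univ = 1) :
    M {f | f.1 t = x} = 1 := by
  rwa [extremalMeasure_singleton, hg, Measure.restrict_apply .univ, univ_inter,
    measure_le_eval_eq_add, hM, add_zero] at h1

variable {η : Ω → C(T, ℝ)}

lemma no_atom_of_extremal (h : IsPoissonRandomMeasure P μ Φ)
    (hη : ∀ᵐ ω ∂P, η ω t = maxFun (Φ ω) t)
    (hi : ∀ᵐ ω ∂P, extremalMeasure (Φ ω) (η ω) {t} univ = 1) :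
    μ {f | 0 < f.1 t} = ∞ ∧ ∀ x : ℝ, 0 < x → μ {f | f.1 t = x} = 0 := by
  constructor
  · by_contra hfin
    have hP : P {ω | Φ ω {f | f.1 t = 0} ∈ ({1}ᶜ : Set ℝ≥0∞) ∧
        Φ ω {f | 0 < f.1 t} ∈ ({0} : Set ℝ≥0∞)} = 0 := by
      refine measure_mono_null ?_ (ae_iff.1 (hη.and hi))
      rintro ω ⟨hne, h0⟩ ⟨he, h1⟩
      refine hne (measure_eval_eq_one_of_extremal ?_ h0 h1)
      rw [he]
      exact le_antisymm ((measure_lt_eval_eq_zero_iff (h.mem_pointMeasures ω) le_rfl).1 h0)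
        (maxFun_nonneg _ _)
    rw [h.measure_mem_and_mem (measurableSet_eval_eq t 0) (measurableSet_lt_eval t 0)
      (disjoint_eval_eq_lt t 0) (measurableSet_singleton 1).compl (measurableSet_singleton 0),
      extendedPoisson_singleton_zero, mul_eq_zero, exp_neg_coe_ennreal_eq_zero] at hP
    exact extendedPoisson_compl_one_ne_zero _ (hP.resolve_right hfin)
  · intro x hx
    -- The count 0 is excluded as well, so that the maximum really equals `x`; any count other than
    -- 1 then contradicts (i).
    have hm : MeasurableSet ({0, 1}ᶜ : Set ℝ≥0∞) := (Set.toFinite _).measurableSet.compl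
    have hP : P {ω | Φ ω {f | f.1 t = x} ∈ ({0, 1}ᶜ : Set ℝ≥0∞) ∧
        Φ ω {f | x < f.1 t} ∈ ({0} : Set ℝ≥0∞)} = 0 := by
      refine measure_mono_null ?_ (ae_iff.1 (hη.and hi))
      rintro ω ⟨hne, h0⟩ ⟨he, h1⟩
      refine hne (Or.inr (measure_eval_eq_one_of_extremal ?_ h0 h1))
      rw [he, h.maxFun_eq_iff ω hx]
      exact ⟨fun h' => hne (Or.inl h'), h0⟩
    rw [h.measure_mem_and_mem (measurableSet_eval_eq t x) (measurableSet_lt_eval t x)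
      (disjoint_eval_eq_lt t x) hm (measurableSet_singleton 0),
      extendedPoisson_singleton_zero, mul_eq_zero, exp_neg_coe_ennreal_eq_zero] at hP
    exact extendedPoisson_compl_zero_one_eq_zero (hP.resolve_right (h.measure_lt_eval_ne_top hx))

lemma ae_extremalMeasure_eq_one (h : IsPoissonRandomMeasure P μ Φ)
    (hη : ∀ᵐ ω ∂P, η ω t = maxFun (Φ ω) t) {A : Set (C0 T)} (hA : MeasurableSet A) :
    ∀ᵐ ω ∂P, ω ∈ (⋃ (n) (k), isolatedMaxEvent Φ t A n k) →
      extremalMeasure (Φ ω) (η ω) {t} univ = 1 ∧ extremalMeasure (Φ ω) (η ω) {t} A = 1 := by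
  filter_upwards [hη] with ω hω hmem
  obtain ⟨n, k, hnk⟩ := mem_iUnion₂.1 hmem
  exact extremalMeasure_of_mem_isolatedMaxEvent hA (h.mem_pointMeasures ω) hω hnk

lemma measurableSet_iUnion_isolatedMaxEvent (h : IsPoissonRandomMeasure P μ Φ)
    {A : Set (C0 T)} (hA : MeasurableSet A) :
    MeasurableSet (⋃ (n) (k), isolatedMaxEvent Φ t A n k) :=
  .iUnion fun n => .iUnion fun k => h.measurableSet_isolatedMaxEvent hA n k

lemma ae_extremalMeasure_univ_eq_one (h : IsPoissonRandomMeasure P μ Φ)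
    (hη : ∀ᵐ ω ∂P, η ω t = maxFun (Φ ω) t)
    (hinf : Tendsto (tail μ t) (𝓝[>] 0) (𝓝 ∞)) (hcont : ContinuousOn (tail μ t) (Ioi 0)) :
    ∀ᵐ ω ∂P, extremalMeasure (Φ ω) (η ω) {t} univ = 1 := by
  have hle := (h.one_le_lintegral_expTail hinf hcont).trans (setLIntegral_univ _ ▸
    h.lintegral_expTail_le (tail_tendsto_top_iff.1 hinf) hcont .univ)
  have hae := (mem_ae_iff_prob_eq_one (h.measurableSet_iUnion_isolatedMaxEvent .univ)).2
    (le_antisymm prob_le_one hle)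
  filter_upwards [h.ae_extremalMeasure_eq_one hη .univ, hae] with ω hω hmem
  exact (hω hmem).1

/-- The events `U` and `V` for `A` and `Aᶜ` force `φ` into `A` and `Aᶜ`. Their probabilities
dominate two integrals of sum at least 1, so `U ∪ V` is almost sure, `U` agrees with `φ ⁻¹' A`
almost surely, and no bound is strict. Measurability of `φ` is a conclusion. -/
lemma preimage_ae_eq_and_measure_eq (h : IsPoissonRandomMeasure P μ Φ)
    (hη : ∀ᵐ ω ∂P, η ω t = maxFun (Φ ω) t)
    (hinf : Tendsto (tail μ t) (𝓝[>] 0) (𝓝 ∞)) (hcont : ContinuousOn (tail μ t) (Ioi 0))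
    {φ : Ω → C0 T} (hφ : ∀ᵐ ω ∂P, extremalMeasure (Φ ω) (η ω) {t} = Measure.dirac (φ ω))
    {A : Set (C0 T)} (hA : MeasurableSet A) :
    NullMeasurableSet (φ ⁻¹' A) P ∧
      P (φ ⁻¹' A) = ∫⁻ f in A, expTail μ t (f.1 t) ∂μ := by
  have hsub : ∀ {B : Set (C0 T)}, MeasurableSet B → ∀ᵐ ω ∂P,
      ω ∈ (⋃ (n) (k), isolatedMaxEvent Φ t B n k) → φ ω ∈ B := by
    intro B hB
    filter_upwards [h.ae_extremalMeasure_eq_one hη hB, hφ] with ω hω hdirac hmem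
    have h1 := (hω hmem).2
    rw [hdirac, Measure.dirac_apply' _ hB] at h1
    by_contra hnot
    simp [hnot] at h1
  have hinf' := tail_tendsto_top_iff.1 hinf
  have hUle := h.lintegral_expTail_le hinf' hcont hA
  have hVle := h.lintegral_expTail_le hinf' hcont hA.compl
  have hUA := hsub hA
  have hVA := hsub hA.compl
  have hUm := h.measurableSet_iUnion_isolatedMaxEvent (t := t) hA
  have hVm := h.measurableSet_iUnion_isolatedMaxEvent (t := t) hA.compl
  set U : Set Ω := ⋃ (n) (k), isolatedMaxEvent Φ t A n k
  set V : Set Ω := ⋃ (n) (k), isolatedMaxEvent Φ t Aᶜ n k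
  have hdisj : AEDisjoint P U V := by
    refine measure_mono_null ?_ (ae_iff.1 (hUA.and hVA))
    rintro ω ⟨hU, hV⟩ ⟨h1, h2⟩
    exact h2 hV (h1 hU)
  have hsum : P (U ∪ V) = P U + P V := measure_union₀ hVm.nullMeasurableSet hdisj
  have hone : 1 ≤ ∫⁻ f in A, expTail μ t (f.1 t) ∂μ + ∫⁻ f in Aᶜ, expTail μ t (f.1 t) ∂μ := by
    rw [lintegral_add_compl _ hA]
    exact h.one_le_lintegral_expTail hinf hcont
  have hunion : ∀ᵐ ω ∂P, ω ∈ U ∪ V :=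
    (mem_ae_iff_prob_eq_one (hUm.union hVm)).2
      (le_antisymm prob_le_one (hsum ▸ hone.trans (add_le_add hUle hVle)))
  have heq : U =ᵐ[P] φ ⁻¹' A := by
    filter_upwards [hUA, hVA, hunion] with ω h1 h2 h3
    refine propext ⟨h1, fun hmem => h3.resolve_right fun hV => h2 hV hmem⟩
  refine ⟨hUm.nullMeasurableSet.congr heq, ?_⟩
  rw [← measure_congr heq]
  refine le_antisymm ?_ hUle
  have hVfin : ∫⁻ f in Aᶜ, expTail μ t (f.1 t) ∂μ ≠ ∞ :=
    ne_top_of_le_ne_top (measure_ne_top P V) hVle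
  refine (ENNReal.add_le_add_iff_right hVfin).1 ?_
  calc P U + ∫⁻ f in Aᶜ, expTail μ t (f.1 t) ∂μ ≤ P U + P V := by gcongr
    _ ≤ 1 := hsum ▸ prob_le_one
    _ ≤ _ := hone

end IsPoissonRandomMeasure

end Extremal

end MaxID

/-! ### The equivalences and the law of the extremal function -/

theorem proposition2p2 {T : Type*} [MetricSpace T] [CompactSpace T]
    {Ω : Type*} [MeasurableSpace Ω] (P : Measure Ω) [IsProbabilityMeasure P]
    (μ : Measure (C0 T)) (Φ : Ω → Measure (C0 T)) (hΦ : IsPoissonRandomMeasure P μ Φ)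
    (η : Ω → C(T, ℝ)) (hη : ∀ᵐ ω ∂P, ∀ s, η ω s = maxFun (Φ ω) s) (t : T) :
    List.TFAE [
      ∀ᵐ ω ∂P, extremalMeasure (Φ ω) (η ω) {t} univ = 1,
      Tendsto (tail μ t) (𝓝[>] 0) (𝓝 ∞) ∧ ContinuousOn (tail μ t) (Ioi 0),
      ∀ y : ℝ, P {ω | η ω t = y} = 0] ∧
    ((∀ᵐ ω ∂P, extremalMeasure (Φ ω) (η ω) {t} univ = 1) →
      (∃ φ : Ω → C0 T, Measurable φ ∧
        ∀ᵐ ω ∂P, extremalMeasure (Φ ω) (η ω) {t} = Measure.dirac (φ ω)) ∧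
      ∀ φ : Ω → C0 T,
        (∀ᵐ ω ∂P, extremalMeasure (Φ ω) (η ω) {t} = Measure.dirac (φ ω)) →
        AEMeasurable φ P ∧
        ∀ A : Set (C0 T), MeasurableSet A →
          P (φ ⁻¹' A) = ∫⁻ f in A, EReal.exp (-(tail μ t (f.1 t) : EReal)) ∂μ) := by
  have hηt : ∀ᵐ ω ∂P, η ω t = maxFun (Φ ω) t := hη.mono fun ω h => h t
  have h12 : (∀ᵐ ω ∂P, extremalMeasure (Φ ω) (η ω) {t} univ = 1) →
      Tendsto (tail μ t) (𝓝[>] 0) (𝓝 ∞) ∧ ContinuousOn (tail μ t) (Ioi 0) := fun hi =>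
    hΦ.tail_tendsto_top_and_continuousOn_iff.2 (hΦ.no_atom_of_extremal hηt hi)
  have h23 : (Tendsto (tail μ t) (𝓝[>] 0) (𝓝 ∞) ∧ ContinuousOn (tail μ t) (Ioi 0)) ↔
      ∀ y : ℝ, P {ω | η ω t = y} = 0 := by
    rw [hΦ.tail_tendsto_top_and_continuousOn_iff, ← hΦ.forall_measure_maxFun_eq_zero_iff]
    refine forall_congr' fun y => ?_
    rw [measure_congr (s := {ω | η ω t = y}) (t := {ω | maxFun (Φ ω) t = y})]
    filter_upwards [hηt] with ω hω
    exact congrArg (· = y) hω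
  refine ⟨?_, fun hi => ?_⟩
  · tfae_have 1 → 2 := h12
    tfae_have 2 → 1 := fun h => hΦ.ae_extremalMeasure_univ_eq_one hηt h.1 h.2
    tfae_have 2 ↔ 3 := h23
    tfae_finish
  obtain ⟨hinf, hcont⟩ := h12 hi
  have hlaw : ∀ φ : Ω → C0 T,
      (∀ᵐ ω ∂P, extremalMeasure (Φ ω) (η ω) {t} = Measure.dirac (φ ω)) →
      AEMeasurable φ P ∧ ∀ A : Set (C0 T), MeasurableSet A →
        P (φ ⁻¹' A) = ∫⁻ f in A, EReal.exp (-(tail μ t (f.1 t) : EReal)) ∂μ := fun φ hφ =>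
    -- Metrizability of `T` enters here: it makes `C(T, ℝ)` separable, so the Borel σ-algebra of `C0
    -- T` is countably generated.
    ⟨NullMeasurable.aemeasurable fun A hA =>
      (hΦ.preimage_ae_eq_and_measure_eq hηt hinf hcont hφ hA).1,
      fun A hA => (hΦ.preimage_ae_eq_and_measure_eq hηt hinf hcont hφ hA).2⟩
  refine ⟨?_, hlaw⟩
  have hne : Nonempty (C0 T) := ⟨⟨1, fun _ => zero_le_one, fun h =>
    one_ne_zero (DFunLike.congr_fun h t : (1 : ℝ) = 0)⟩⟩
  have hex : ∀ ω, ∃ g : C0 T, extremalMeasure (Φ ω) (η ω) {t} univ = 1 →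
      extremalMeasure (Φ ω) (η ω) {t} = Measure.dirac g := by
    intro ω
    by_cases h1 : extremalMeasure (Φ ω) (η ω) {t} univ = 1
    · rw [extremalMeasure_singleton] at h1 ⊢
      obtain ⟨g, hg⟩ := exists_restrict_eq_dirac (hΦ.mem_pointMeasures ω)
        (measurableSet_le_eval t (η ω t)) (by simpa using h1)
      exact ⟨g, fun _ => hg⟩
    · exact ⟨Classical.arbitrary _, fun h => absurd h h1⟩
  choose φ hφ using hex
  have hφ' : ∀ᵐ ω ∂P, extremalMeasure (Φ ω) (η ω) {t} = Measure.dirac (φ ω) := by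
    filter_upwards [hi] with ω hω using hφ ω hω
  -- The pointwise choice of `φ` carries no measurability; `hlaw` supplies it almost everywhere, and
  -- `hm.mk` is a measurable version.
  have hm := (hlaw φ hφ').1
  refine ⟨hm.mk φ, hm.measurable_mk, ?_⟩
  filter_upwards [hφ', hm.ae_eq_mk] with ω h1 h2
  rw [h1, h2]
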